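/- Let $d\ge 1$ and $r\in\mathbb{R}$. Consider $d$ bosonic modes $A_1,\dots,A_d$ and $d$ bosonic modes $E_1,\dots,E_d$ with annihilation operators $a_i$, $e_i$ and number states $|n_1,\dots,n_d\rangle$, and let $\mathcal U=\bigotimes_{i=1}^d \mathcal U_{A_iE_i}(r)$ with $$\mathcal U_{A_iE_i}(r)=\frac1{\cosh r}\,e^{\tanh r\, a_i^\dagger e_i^\dagger}\,e^{-\ln(\cosh r)\,(a_i^\dagger a_i+e_i^\dagger e_i)}\,e^{-\tanh r\, a_ie_i}.$$ Identify $\mathbb{C}^d$ with the single-excitation space spanned by $a_i^\dagger|\mathrm{vac}\rangle_A$, $1\le i\le d$. For an operator $\rho$ on $\mathbb{C}^d$, the qudit Unruh channel is $$\mathcal N(\rho)=\mathrm{Tr}_E\big(\mathcal U\,(\rho\otimes|\mathrm{vac}\rangle\langle\mathrm{vac}|_E)\,\mathcal U^\dagger\big),$$ where after $\mathcal U$ the $A$ modes are called $B$, and let $$\mathcal N^{C}(\rho)=\mathrm{Tr}_B\big(\mathcal U\,(\rho\otimes|\mathrm{vac}\rangle\langle\mathrm{vac}|_E)\,\mathcal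 U^\dagger\big).$$ Then $\mathcal N$ is a Hadamard channel. That is, $\mathcal U$ is an isometry on these inputs, so that $\mathcal N$ and $\mathcal N^C$ are complementary quantum channels, and $\mathcal N^C$ is entanglement-breaking: for every $n$ and every density matrix $\rho$ on $\mathbb{C}^n\otimes\mathbb{C}^d$ (in particular for the maximally entangled state of $\mathbb{C}^d\otimes\mathbb{C}^d$), the state $(\mathrm{id}\otimes\mathcal N^C)(\rho)$ is separable, i.e. of the form $\sum_x p_x\,\rho_x\otimes\sigma_x$ for a finite or countable probability distribution $(p_x)$ and density operators $\rho_x$, $\sigma_x$. -/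

import Mathlib

noncomputable section

namespace QuditUnruh

open scoped Matrix ComplexOrder

/-! ### States, separable states and entanglement-breaking maps

Operators on the Hilbert space with orthonormal basis indexed by `ι` (finite or infinite) are given
by their matrices in that basis. -/

/-- Density matrices: positive semidefinite (on finitely supported vectors, as in Mathlib) and of
trace one.  For infinite `ι` these are exactly the matrices of the positive trace-class operators
of trace one on `ℓ²(ι)`. -/
def IsDensity {ι : Type*} (M : Matrix ι ι ℂ) : Prop :=
  M.PosSemidef ∧ HasSum (fun i => M i i) 1

/-- A bipartite state is separable if it is a (finite or countable) convex combination
`∑ₓ p(x) ρₓ ⊗ σₓ` of product states.  Since `p` is summable, the entrywise convergence required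
here is the same as convergence of the series in trace norm. -/
def IsSeparable {α ε : Type*} (τ : Matrix (α × ε) (α × ε) ℂ) : Prop :=
  ∃ (p : ℕ → ℝ) (ρ : ℕ → Matrix α α ℂ) (σ : ℕ → Matrix ε ε ℂ),
    (∀ x, 0 ≤ p x) ∧ HasSum p 1 ∧ (∀ x, IsDensity (ρ x)) ∧ (∀ x, IsDensity (σ x)) ∧
      ∀ s t : α × ε, HasSum (fun x => (p x : ℂ) * (ρ x s.1 t.1 * σ x s.2 t.2)) (τ s t)

/-- The ampliation `id ⊗ Φ` of a map `Φ` by a reference system with basis `α`. -/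
def ampliation {ι ε : Type*} (α : Type*) (Φ : Matrix ι ι ℂ → Matrix ε ε ℂ)
    (ρ : Matrix (α × ι) (α × ι) ℂ) : Matrix (α × ε) (α × ε) ℂ :=
  fun s t => Φ (fun i j => ρ (s.1, i) (t.1, j)) s.2 t.2

/-- `Φ` is entanglement-breaking: for every finite-dimensional reference system and every joint
input state, maximally entangled ones included, the output state of `id ⊗ Φ` is separable. -/
def IsEntanglementBreaking {ι ε : Type*} (Φ : Matrix ι ι ℂ → Matrix ε ε ℂ) : Prop :=
  ∀ (n : ℕ) (ρ : Matrix (Fin n × ι) (Fin n × ι) ℂ),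
    IsDensity ρ → IsSeparable (ampliation (Fin n) Φ ρ)

/-! ### Channels, complementary channels and Hadamard channels -/

/-- Partial trace over the second factor. -/
def traceSnd {β ε : Type*} (M : Matrix (β × ε) (β × ε) ℂ) : Matrix β β ℂ :=
  fun b b' => ∑' e, M (b, e) (b', e)

/-- Partial trace over the first factor. -/
def traceFst {β ε : Type*} (M : Matrix (β × ε) (β × ε) ℂ) : Matrix ε ε ℂ :=
  fun e e' => ∑' b, M (b, e) (b, e')

/-- `V` is the matrix of an isometry into `ℓ²(κ)`: its columns are square-summable and
orthonormal. -/
def IsIsometry {κ ι : Type*} [DecidableEq ι] (V : Matrix κ ι ℂ) : Prop :=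
  ∀ i j, HasSum (fun x => star (V x i) * V x j) (if i = j then 1 else 0)

/-- `N` is a quantum channel with complementary channel `Nc`: there is an isometry `V` from the
input space into `B ⊗ E` with `N ρ = Tr_E (V ρ V†)` and `Nc ρ = Tr_B (V ρ V†)`. -/
def IsComplementary {ι β ε : Type*} [Fintype ι] [DecidableEq ι]
    (N : Matrix ι ι ℂ → Matrix β β ℂ) (Nc : Matrix ι ι ℂ → Matrix ε ε ℂ) : Prop :=
  ∃ V : Matrix (β × ε) ι ℂ, IsIsometry V ∧
    (∀ ρ, N ρ = traceSnd (V * ρ * Vᴴ)) ∧ ∀ ρ, Nc ρ = traceFst (V * ρ * Vᴴ)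

/-- `N` is a Hadamard channel: it has an entanglement-breaking complementary channel.
(Complementary channels are unique up to partial isometries of the environment, which preserve
this property.) -/
def IsHadamard {ι β : Type*} [Fintype ι] [DecidableEq ι]
    (N : Matrix ι ι ℂ → Matrix β β ℂ) : Prop :=
  ∃ (ε : Type) (Nc : Matrix ι ι ℂ → Matrix ε ε ℂ),
    IsComplementary N Nc ∧ IsEntanglementBreaking Nc

/-! ### One pair of bosonic modes `A_i E_i`

A vector is given by its coefficients `f (m, n)` in the number basis `|m⟩_A |n⟩_E`.  The ladder
operators make sense on arbitrary coefficient families, so no domain has to be fixed. -/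

/-- Creation operator of the `A` mode: `a† |m, n⟩ = √(m + 1) |m + 1, n⟩`. -/
def aDag : Module.End ℂ (ℕ × ℕ → ℂ) where
  toFun f := fun x => (Real.sqrt x.1 : ℂ) * (if x.1 = 0 then 0 else f (x.1 - 1, x.2))
  map_add' f g := by funext x; by_cases h : x.1 = 0 <;> simp [h, mul_add]
  map_smul' c f := by funext x; by_cases h : x.1 = 0 <;> simp [h, mul_left_comm]

/-- Annihilation operator of the `A` mode: `a |m, n⟩ = √m |m - 1, n⟩`. -/
def aAnn : Module.End ℂ (ℕ × ℕ → ℂ) where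
  toFun f := fun x => (Real.sqrt (x.1 + 1) : ℂ) * f (x.1 + 1, x.2)
  map_add' f g := by funext x; simp [mul_add]
  map_smul' c f := by funext x; simp [mul_left_comm]

/-- Creation operator of the `E` mode: `e† |m, n⟩ = √(n + 1) |m, n + 1⟩`. -/
def eDag : Module.End ℂ (ℕ × ℕ → ℂ) where
  toFun f := fun x => (Real.sqrt x.2 : ℂ) * (if x.2 = 0 then 0 else f (x.1, x.2 - 1))
  map_add' f g := by funext x; by_cases h : x.2 = 0 <;> simp [h, mul_add]
  map_smul' c f := by funext x; by_cases h : x.2 = 0 <;> simp [h, mul_left_comm]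

/-- Annihilation operator of the `E` mode: `e |m, n⟩ = √n |m, n - 1⟩`. -/
def eAnn : Module.End ℂ (ℕ × ℕ → ℂ) where
  toFun f := fun x => (Real.sqrt (x.2 + 1) : ℂ) * f (x.1, x.2 + 1)
  map_add' f g := by funext x; simp [mul_add]
  map_smul' c f := by funext x; simp [mul_left_comm]

/-- `exp[X] f = ∑ₗ Xˡ f / l!`, the series being taken coefficientwise. -/
def opExp (X : Module.End ℂ (ℕ × ℕ → ℂ)) (f : ℕ × ℕ → ℂ) : ℕ × ℕ → ℂ :=
  fun x => ∑' l : ℕ, ((l.factorial : ℂ))⁻¹ * (X ^ l) f x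

/-- The two-mode transformation
`U(r) = (cosh r)⁻¹ exp[tanh r a† e†] exp[-ln(cosh r) (a† a + e† e)] exp[-tanh r a e]`
applied to a vector `f`. -/
def modeU (r : ℝ) (f : ℕ × ℕ → ℂ) : ℕ × ℕ → ℂ :=
  ((Real.cosh r : ℂ)⁻¹) •
    opExp ((Real.tanh r : ℂ) • (aDag * eDag))
      (opExp ((-Real.log (Real.cosh r) : ℂ) • (aDag * aAnn + eDag * eAnn))
        (opExp ((-Real.tanh r : ℂ) • (aAnn * eAnn)) f))

/-! ### The qudit Unruh channel -/

/-- Labels `(n₁, …, n_d)` of the `d`-mode number states. -/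
abbrev Occ (d : ℕ) : Type := Fin d → ℕ

/-- Matrix of `𝒰 = ⨂ᵢ U_{A_i E_i}(r)` in the number basis `|m⟩_A |n⟩_E` of the `2 d` modes:
the entry at `(x, y)` is `∏ᵢ ⟨x_i| U(r) |y_i⟩`. -/
def unruhU (d : ℕ) (r : ℝ) : Matrix (Occ d × Occ d) (Occ d × Occ d) ℂ :=
  fun x y => ∏ i, modeU r (Pi.single (y.1 i, y.2 i) 1) (x.1 i, x.2 i)

/-- The basis state `a_i† |vac⟩_A |vac⟩_E = |(0, …, 1_i, …, 0)⟩_A |vac⟩_E`. -/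
def singleExc (d : ℕ) (i : Fin d) : Occ d × Occ d := (Pi.single i 1, 0)

/-- `𝒰` restricted to the inputs `(∑ᵢ βᵢ a_i† |vac⟩_A) |vac⟩_E`, `β ∈ ℂᵈ`. -/
def unruhV (d : ℕ) (r : ℝ) : Matrix (Occ d × Occ d) (Fin d) ℂ :=
  (unruhU d r).submatrix id (singleExc d)

/-- The qudit Unruh channel `ρ ↦ Tr_E (𝒰 (ρ ⊗ |vac⟩⟨vac|_E) 𝒰†)`, for `ρ` an operator on the
single-excitation space `ℂᵈ` of the sender. -/
def unruhChannel (d : ℕ) (r : ℝ) (ρ : Matrix (Fin d) (Fin d) ℂ) : Matrix (Occ d) (Occ d) ℂ :=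
  traceSnd (unruhV d r * ρ * (unruhV d r)ᴴ)

/-- Its complementary channel `ρ ↦ Tr_B (𝒰 (ρ ⊗ |vac⟩⟨vac|_E) 𝒰†)`. -/
def unruhComplement (d : ℕ) (r : ℝ) (ρ : Matrix (Fin d) (Fin d) ℂ) : Matrix (Occ d) (Occ d) ℂ :=
  traceFst (unruhV d r * ρ * (unruhV d r)ᴴ)

end QuditUnruh

end

/-!
The image of `aᵢ† |vac⟩_A |vac⟩_E` under `𝒰` is `∑ₑ vᵢ(e) |e + 1ᵢ⟩_B |e⟩_E` with
`vᵢ(e) = (cosh r)^(-d-1) (tanh r)^|e| √(eᵢ + 1)` (`unruhV_apply`): the two right-hand factors of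
`modeU` act on eigenvectors, and the left one gives a power series in `tanh r`.  Since `1 - tanh² r = cosh⁻² r`, these vectors are
orthonormal (`isIsometry_unruhV`), so `𝒩` and `𝒩ᶜ` are complementary channels.

Tracing out `B` gives, with `t = tanh r` and `n̂` the excitation number of the environment,
`𝒩ᶜ(ρ) = (cosh r)^(-2d-2) t^n̂ (∑ᵢⱼ ρᵢⱼ eᵢ eⱼ†) t^n̂`, which is antinormally ordered.
Such an operator is a Gaussian average of coherent states,
`∑ᵢⱼ ρᵢⱼ eᵢ eⱼ† = ∫ (∑ᵢⱼ ρᵢⱼ zᵢ z̄ⱼ) |z⟩⟨z| dμ(z)`, and the weight `∑ᵢⱼ ρᵢⱼ zᵢ z̄ⱼ` is nonnegative: the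
channel measures its input and prepares a coherent state, hence is entanglement-breaking.

Separability is required as a countable sum, so the integral has to be discretised.  The output
commutes with `n̂`, and on the block `n̂ = N` only moments `z^a z̄^b` of order at most `N + 1` in each
variable enter.  For these the Gaussian measure on `ℂ` can be replaced by a finite positive quadrature
rule (`exists_complex_quadrature`), whose radial part exists by a convexity argument
(`exists_finite_factorial_moments`) and whose angular part uses roots of unity.  The `d`-fold
product rules, over all `N`, write `(id ⊗ 𝒩ᶜ)(ρ)` as a countable sum of products of positive
matrices (`sum_quadrature_truncCoherent`), and `isSeparable_of_hasSum` normalises them.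
-/

noncomputable section

namespace QuditUnruh

open scoped Matrix ComplexOrder

/-! ### The two-mode transformation on at most one excitation -/

lemma opExp_smul (X : Module.End ℂ (ℕ × ℕ → ℂ)) (c : ℂ) (f : ℕ × ℕ → ℂ) :
    opExp X (c • f) = c • opExp X f := by
  funext x
  simp only [opExp, map_smul, Pi.smul_apply, smul_eq_mul, mul_left_comm _ c]
  exact tsum_mul_left

/-- On an eigenvector the coefficientwise operator exponential is the scalar exponential. -/
lemma opExp_of_eigenvector {X : Module.End ℂ (ℕ × ℕ → ℂ)} {f : ℕ × ℕ → ℂ} {c : ℂ}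
    (h : X f = c • f) : opExp X f = Complex.exp c • f := by
  have hpow : ∀ l : ℕ, (X ^ l) f = c ^ l • f := by
    intro l
    induction l with
    | zero => simp
    | succ l ih => rw [pow_succ', Module.End.mul_apply, ih, map_smul, h, smul_smul, pow_succ]
  funext x
  have hs : HasSum (fun l : ℕ => ((l.factorial : ℂ))⁻¹ * c ^ l) (Complex.exp c) := by
    have := NormedSpace.expSeries_div_hasSum_exp (𝔸 := ℂ) c
    rw [← Complex.exp_eq_exp_ℂ] at this
    simpa [div_eq_inv_mul] using this
  have := (hs.mul_right (f x)).tsum_eq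
  simpa [opExp, hpow, mul_assoc] using this

lemma annPair_single (m : ℕ) : (aAnn * eAnn) (Pi.single (m, 0) 1) = 0 := by
  funext x
  simp [aAnn, eAnn]

lemma number_single (m : ℕ) :
    (aDag * aAnn + eDag * eAnn) (Pi.single (m, 0) 1) = (m : ℂ) • Pi.single (m, 0) 1 := by
  funext ⟨x, y⟩
  simp only [LinearMap.add_apply, Module.End.mul_apply, aDag, aAnn, eDag, eAnn, LinearMap.coe_mk,
    AddHom.coe_mk, Pi.add_apply, Pi.single_apply, Pi.smul_apply, Prod.mk.injEq, smul_eq_mul]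
  rcases x with _ | x
  · rcases y with _ | y <;> simp +contextual [eq_comm]
  · have hx : ((√((x : ℝ) + 1) : ℝ) : ℂ) * (√((x : ℝ) + 1) : ℝ) = x + 1 := by
      rw [← Complex.ofReal_mul, Real.mul_self_sqrt (by positivity)]; simp
    by_cases hm : x + 1 = m
    · subst hm
      rcases y with _ | y <;> simp [hx]
    · rcases y with _ | y <;> simp [hm]

/-- `(a† e†)ˡ |m, 0⟩ = √((m + l)! / m!) √(l!) |m + l, l⟩`. -/
lemma dagPair_pow_single (m l : ℕ) :
    ((aDag * eDag) ^ l) (Pi.single (m, 0) 1) =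
      ((√((m + 1).ascFactorial l) * √l.factorial : ℝ) : ℂ) • Pi.single (m + l, l) 1 := by
  induction l with
  | zero => simp
  | succ l ih =>
    have h1 : (√((m + 1).ascFactorial (l + 1)) : ℝ) =
        √((m + l : ℕ) + 1 : ℝ) * √((m + 1).ascFactorial l) := by
      rw [Nat.ascFactorial_succ, ← Real.sqrt_mul (by positivity)]
      congr 1; push_cast; ring
    have h2 : (√(l + 1).factorial : ℝ) = √((l : ℝ) + 1) * √l.factorial := by
      rw [Nat.factorial_succ, ← Real.sqrt_mul (by positivity)]
      congr 1; push_cast; ring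
    rw [pow_succ', Module.End.mul_apply, ih, map_smul, h1, h2]
    funext ⟨x, y⟩
    simp only [Module.End.mul_apply, aDag, eDag, LinearMap.coe_mk,
      AddHom.coe_mk, Pi.single_apply, Pi.smul_apply, Prod.mk.injEq, smul_eq_mul]
    rcases x with _ | x
    · simp [← add_assoc]
    rcases y with _ | y
    · simp
    by_cases hx : x = m + l
    · by_cases hy : y = l
      · subst hx hy
        simp [← add_assoc]
        ring
      · simp [hy]
    · simp [hx, ← add_assoc]

/-- The two-mode transformation on `|0, 0⟩` and `|1, 0⟩`:
`U |m, 0⟩ = (cosh r)^(-1-m) ∑ₙ (tanh r)ⁿ √(n + 1)^m |n + m, n⟩`. -/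
lemma modeU_single (r : ℝ) {m : ℕ} (hm : m ≤ 1) (x y : ℕ) :
    modeU r (Pi.single (m, 0) 1) (x, y) =
      if x = y + m then
        (((Real.cosh r)⁻¹ ^ (m + 1) * Real.tanh r ^ y * √((y : ℝ) + 1) ^ m : ℝ) : ℂ) else 0 := by
  -- `a e` annihilates `|m, 0⟩`, so the rightmost exponential acts trivially.
  have h1 : opExp ((-Real.tanh r : ℂ) • (aAnn * eAnn)) (Pi.single (m, 0) 1) =
      Pi.single (m, 0) 1 := by
    rw [opExp_of_eigenvector (c := 0)]
    · simp
    · rw [LinearMap.smul_apply, annPair_single]; simp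
  have h2 : opExp ((-Real.log (Real.cosh r) : ℂ) • (aDag * aAnn + eDag * eAnn))
      (Pi.single (m, 0) 1) = (((Real.cosh r)⁻¹ ^ m : ℝ) : ℂ) • Pi.single (m, 0) 1 := by
    rw [opExp_of_eigenvector (c := -Real.log (Real.cosh r) * m)]
    · congr 1
      rw [mul_comm, Complex.exp_nat_mul]
      rw [← Complex.ofReal_neg, ← Complex.ofReal_exp, Real.exp_neg,
        Real.exp_log (Real.cosh_pos r)]
      simp
    · rw [LinearMap.smul_apply, number_single, smul_smul]
  have h3 : opExp ((Real.tanh r : ℂ) • (aDag * eDag)) (Pi.single (m, 0) 1) (x, y) =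
      if x = y + m then ((Real.tanh r ^ y * √((y : ℝ) + 1) ^ m : ℝ) : ℂ) else 0 := by
    have hval : (√((m + 1).ascFactorial y) * √y.factorial : ℝ) =
        y.factorial * √((y : ℝ) + 1) ^ m := by
      interval_cases m
      · rw [zero_add, Nat.one_ascFactorial, Real.mul_self_sqrt (by positivity)]; simp
      · have : (1 + 1 : ℕ).ascFactorial y = (y + 1).factorial := by
          have := Nat.factorial_mul_ascFactorial 1 y
          simpa [add_comm] using this
        rw [this, Nat.factorial_succ, Nat.cast_mul, Real.sqrt_mul (by positivity), mul_assoc,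
          Real.mul_self_sqrt (by positivity)]
        push_cast; ring
    simp only [opExp, smul_pow, LinearMap.smul_apply, dagPair_pow_single, Pi.smul_apply,
      Pi.single_apply, Prod.mk.injEq, smul_eq_mul]
    rw [tsum_eq_single y]
    · by_cases hx : x = y + m
      · rw [if_pos ⟨by omega, rfl⟩, if_pos hx, hval]
        have : (y.factorial : ℂ) ≠ 0 := by exact_mod_cast y.factorial_ne_zero
        push_cast
        field_simp
      · rw [if_neg (by omega), if_neg hx]; simp
    · intro l hl
      rw [if_neg (by tauto)]; simp
  simp only [modeU, h1, h2, opExp_smul, Pi.smul_apply, h3, smul_eq_mul]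
  split_ifs
  · push_cast; ring
  · simp

/-! ### The isometry and the complementary channel in the number basis -/

/-- A finite product of nonnegative series is the series over all multi-indices. -/
lemma hasSum_pi_prod_of_nonneg {d : ℕ} {f : Fin d → ℕ → ℝ} {a : Fin d → ℝ}
    (hf : ∀ k n, 0 ≤ f k n) (h : ∀ k, HasSum (f k) (a k)) :
    HasSum (fun e : Fin d → ℕ => ∏ k, f k (e k)) (∏ k, a k) := by
  induction d with
  | zero => simp
  | succ d ih =>
    have h1 := ih (f := fun k => f k.succ) (fun k n => hf _ _) (fun k => h k.succ)
    have hnn : (0 : (Fin d → ℕ) → ℝ) ≤ fun e => ∏ k : Fin d, f k.succ (e k) :=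
      fun e => Finset.prod_nonneg fun k _ => hf _ _
    have hs := (h 0).summable.mul_of_nonneg h1.summable (hf 0) hnn
    have h2 := (h 0).mul h1 hs
    rw [Fin.prod_univ_succ]
    refine (Equiv.hasSum_iff (Fin.consEquiv fun _ : Fin (d + 1) => ℕ)).mp ?_
    refine h2.congr_fun fun x => ?_
    simp [Fin.prod_univ_succ, Fin.consEquiv]

/-- The amplitude of `|e + 1ᵢ⟩_B |e⟩_E` in the image of `aᵢ† |vac⟩_A |vac⟩_E`. -/
def amplitude {d : ℕ} (r : ℝ) (e : Occ d) (i : Fin d) : ℝ :=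
  (Real.cosh r)⁻¹ ^ (d + 1) * Real.tanh r ^ (∑ k, e k) * √((e i : ℝ) + 1)

lemma amplitude_eq_prod {d : ℕ} (r : ℝ) (e : Occ d) (i : Fin d) :
    amplitude r e i = ∏ k, ((Real.cosh r)⁻¹ ^ ((Pi.single i 1 : Occ d) k + 1) *
      Real.tanh r ^ e k * √((e k : ℝ) + 1) ^ (Pi.single i 1 : Occ d) k) := by
  rw [Finset.prod_mul_distrib, Finset.prod_mul_distrib, Finset.prod_pow_eq_pow_sum,
    Finset.prod_pow_eq_pow_sum, Finset.prod_eq_single i]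
  · simp [amplitude, Finset.sum_add_distrib, add_comm]
  · intro k _ hk; simp [hk]
  · simp

lemma unruhV_apply (d : ℕ) (r : ℝ) (b e : Occ d) (i : Fin d) :
    unruhV d r (b, e) i =
      if b = e + Pi.single i 1 then (amplitude r e i : ℂ) else 0 := by
  have hle : ∀ k, (Pi.single i 1 : Occ d) k ≤ 1 := fun k => by
    rw [Pi.single_apply]; split_ifs <;> simp
  simp only [unruhV, Matrix.submatrix_apply, unruhU, singleExc, id, Pi.zero_apply,
    modeU_single r (hle _)]
  rw [Finset.prod_ite_zero, amplitude_eq_prod]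
  simp only [funext_iff, Finset.mem_univ, true_imp_iff, Pi.add_apply, Complex.ofReal_prod]

lemma one_sub_tanh_sq (r : ℝ) : 1 - Real.tanh r ^ 2 = (Real.cosh r)⁻¹ ^ 2 := by
  have := (Real.cosh_pos r).ne'
  rw [Real.tanh_eq_sinh_div_cosh]
  field_simp
  rw [Real.cosh_sq]; ring

/-- The images of the single-excitation states are unit vectors. -/
lemma hasSum_amplitude_sq {d : ℕ} (r : ℝ) (i : Fin d) :
    HasSum (fun e : Occ d => amplitude r e i ^ 2) 1 := by
  have hc := Real.cosh_pos r
  have hq : Real.tanh r ^ 2 < 1 := by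
    have := one_sub_tanh_sq r
    have : 0 < (Real.cosh r)⁻¹ ^ 2 := by positivity
    linarith
  have hq' : ‖Real.tanh r ^ 2‖ < 1 := by rwa [Real.norm_of_nonneg (sq_nonneg _)]
  have key : ∀ m ≤ 1, HasSum (fun n : ℕ => ((Real.cosh r)⁻¹ ^ (m + 1) * Real.tanh r ^ n *
      √((n : ℝ) + 1) ^ m) ^ 2) 1 := by
    intro m hm
    have h := (hasSum_choose_mul_geometric_of_norm_lt_one m hq').mul_left
      ((Real.cosh r)⁻¹ ^ (2 * (m + 1)))
    -- `∑ₙ C(n + m, m) qⁿ = (1 - q)^(-m-1)` with `q = tanh² r` and `1 - q = cosh⁻² r`.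
    rw [one_sub_tanh_sq, ← pow_mul, mul_one_div_cancel (by positivity)] at h
    refine h.congr_fun fun n => ?_
    have h1 : ((√((n : ℝ) + 1)) ^ m) ^ 2 = ((n + m).choose m : ℝ) := by
      rw [← pow_mul, mul_comm, pow_mul, Real.sq_sqrt (by positivity)]
      interval_cases m <;> simp
    rw [mul_pow, mul_pow, h1]
    ring
  simp only [amplitude_eq_prod, ← Finset.prod_pow]
  have := hasSum_pi_prod_of_nonneg (f := fun k n => ((Real.cosh r)⁻¹ ^
    ((Pi.single i 1 : Occ d) k + 1) * Real.tanh r ^ n *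
      √((n : ℝ) + 1) ^ (Pi.single i 1 : Occ d) k) ^ 2) (a := fun _ => 1)
      (fun k n => sq_nonneg _) fun k => key _ (by rw [Pi.single_apply]; split_ifs <;> simp)
  simpa using this

lemma isIsometry_unruhV (d : ℕ) (r : ℝ) : IsIsometry (unruhV d r) := by
  intro i j
  split_ifs with hij
  · subst hij
    have hinj : Function.Injective fun e : Occ d => (e + Pi.single i 1, e) := fun e e' h =>
      (Prod.mk.inj h).2
    refine (hinj.hasSum_iff fun x hx => ?_).mp ?_
    · obtain ⟨b, e⟩ := x
      rw [unruhV_apply, if_neg, mul_zero]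
      rintro rfl
      exact hx ⟨e, rfl⟩
    · have := Complex.hasSum_ofReal.mpr (hasSum_amplitude_sq r i)
      convert this using 2 with e
      · simp [unruhV_apply, sq]
      · simp
  · convert hasSum_zero with x
    obtain ⟨b, e⟩ := x
    rw [unruhV_apply, unruhV_apply]
    split_ifs with h1 h2 <;> try simp
    have := congrFun (add_left_cancel (h1.symm.trans h2)) i
    simp [hij] at this

lemma isComplementary_unruh (d : ℕ) (r : ℝ) :
    IsComplementary (unruhChannel d r) (unruhComplement d r) :=
  ⟨unruhV d r, isIsometry_unruhV d r, fun _ => rfl, fun _ => rfl⟩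

/-- The complementary channel in the number basis; its output is block diagonal with respect to the
total number of excitations. -/
lemma unruhComplement_apply (d : ℕ) (r : ℝ) (ρ : Matrix (Fin d) (Fin d) ℂ) (e e' : Occ d) :
    unruhComplement d r ρ e e' = ∑ i, ∑ j,
      if e + Pi.single i 1 = e' + Pi.single j 1 then
        ρ i j * (amplitude r e i * amplitude r e' j) else 0 := by
  rw [unruhComplement, traceFst]
  refine HasSum.tsum_eq ?_
  have h : ∀ b, (unruhV d r * ρ * (unruhV d r)ᴴ) (b, e) (b, e') =
      ∑ i, ∑ j, if b = e + Pi.single i 1 then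
        (if e + Pi.single i 1 = e' + Pi.single j 1 then
          ρ i j * (amplitude r e i * amplitude r e' j) else 0) else 0 := by
    intro b
    simp only [Matrix.mul_apply, Matrix.conjTranspose_apply, unruhV_apply, Finset.sum_mul]
    rw [Finset.sum_comm]
    refine Finset.sum_congr rfl fun i _ => Finset.sum_congr rfl fun j _ => ?_
    by_cases h1 : b = e + Pi.single i 1
    · subst h1
      rw [if_pos rfl, if_pos rfl]
      split_ifs
      · simp; ring
      · simp
    · simp [h1]
  simp only [h]
  exact hasSum_sum fun i _ => hasSum_sum fun j _ => hasSum_ite_eq _ _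

/-! ### Finite quadrature for Gaussian moments -/

/-- In finite dimension the convex hull of a compact set is compact: by Carathéodory's theorem only
convex combinations of boundedly many points are needed. -/
lemma isCompact_convexHull_of_isCompact {E : Type*} [NormedAddCommGroup E] [NormedSpace ℝ E]
    [FiniteDimensional ℝ E] {K : Set E} (hK : IsCompact K) : IsCompact (convexHull ℝ K) := by
  let F (n : ℕ) (p : (Fin n → ℝ) × (Fin n → E)) : E := ∑ i, p.1 i • p.2 i
  have hF : convexHull ℝ K = ⋃ n ∈ Finset.range (Module.finrank ℝ E + 2),
      F n '' (stdSimplex ℝ (Fin n) ×ˢ Set.univ.pi fun _ => K) := by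
    apply Set.Subset.antisymm
    · intro x hx
      obtain ⟨ι, _, z, w, hz, hind, hw, hw1, rfl⟩ := eq_pos_convex_span_of_mem_convexHull hx
      have e := Fintype.equivFin ι
      refine Set.mem_biUnion (x := Fintype.card ι) ?_ ⟨(w ∘ e.symm, z ∘ e.symm),
        ⟨⟨fun i => (hw _).le, ?_⟩, fun i _ => hz ⟨_, rfl⟩⟩, ?_⟩
      · have := hind.card_le_finrank_succ
        have := (vectorSpan ℝ (Set.range z)).finrank_le
        simp only [Finset.coe_range, Set.mem_Iio]
        omega
      · rw [← hw1]; exact e.symm.sum_comp w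
      · exact e.symm.sum_comp fun i => w i • z i
    · simp only [Set.iUnion_subset_iff]
      rintro n - _ ⟨p, ⟨hp, hpK⟩, rfl⟩
      exact (convex_convexHull ℝ K).sum_mem (fun i _ => hp.1 i) hp.2
        fun i _ => subset_convexHull ℝ K (hpK i trivial)
  rw [hF]
  refine (Finset.range _).finite_toSet.isCompact_biUnion fun n _ => ?_
  exact ((isCompact_stdSimplex ℝ (Fin n)).prod (isCompact_univ_pi fun _ => hK)).image
    (by fun_prop)

open MeasureTheory in
/-- A finite quadrature rule on `[0, ∞)` with the moments `m!` of the exponential distribution, up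
to any prescribed order `M`.  The substitution `s = x / (1 + x)` turns `x ^ m` into
`s ^ m (1 - s) ^ (M + 1 - m)` up to the weight `(1 + x) ^ (M + 1)`, hence into a continuous curve
over `[0, 1]`, whose convex hull is closed and contains the mean of the curve.  The exponent
`M + 1` makes the curve vanish at `s = 1`, so that a node at `x = ∞` contributes nothing. -/
lemma exists_finite_factorial_moments (M : ℕ) :
    ∃ (ι : Type) (_ : Fintype ι) (w x : ι → ℝ), (∀ j, 0 ≤ w j) ∧ (∀ j, 0 ≤ x j) ∧
      ∀ m ≤ M, ∑ j, w j * x j ^ m = m.factorial := by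
  let g : ℝ → (Fin (M + 1) → ℝ) := fun s m => s ^ (m : ℕ) * (1 - s) ^ (M + 1 - m)
  have hg : Continuous g := by fun_prop
  have hK : IsCompact (g '' Set.Icc 0 1) := isCompact_Icc.image hg
  have hC : IsCompact (convexHull ℝ (g '' Set.Icc 0 1)) := isCompact_convexHull_of_isCompact hK
  let f : ℝ → (Fin (M + 1) → ℝ) := fun x => g (x / (1 + x))
  let D : ℝ → NNReal := fun x => ((1 + x) ^ (M + 1) * Real.exp (-x)).toNNReal
  have hD : Measurable D := by fun_prop
  let ν : Measure ℝ := (volume.restrict (Set.Ioi 0)).withDensity fun x => D x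
  have hmom : ∀ m : ℕ, IntegrableOn (fun x : ℝ => x ^ m * Real.exp (-x)) (Set.Ioi 0) := by
    intro m
    have := Real.GammaIntegral_convergent (s := m + 1) (by positivity)
    simpa [mul_comm] using this
  have hDint : IntegrableOn (fun x : ℝ => (1 + x) ^ (M + 1) * Real.exp (-x)) (Set.Ioi 0) := by
    simp only [add_comm (1 : ℝ), add_pow, Finset.sum_mul, one_pow, mul_one]
    refine integrable_finsetSum _ fun i _ => ?_
    refine ((hmom i).mul_const ((M + 1).choose i : ℝ)).congr (.of_forall fun x => ?_)
    ring
  have hfin : IsFiniteMeasure ν := by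
    refine isFiniteMeasure_withDensity_ofReal hDint.2
  have hfC : ∀ᵐ x ∂ν, f x ∈ convexHull ℝ (g '' Set.Icc 0 1) := by
    refine (withDensity_absolutelyContinuous _ _).ae_le ?_
    filter_upwards [ae_restrict_mem measurableSet_Ioi] with x hx
    have hx : 0 < x := hx
    refine subset_convexHull _ _ ⟨_, ⟨by positivity, ?_⟩, rfl⟩
    rw [div_le_one (by positivity)]; linarith
  have hfm : Measurable f := hg.measurable.comp (by fun_prop)
  obtain ⟨R, hR⟩ := hC.isBounded.exists_norm_le
  have hfint : Integrable f ν :=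
    Integrable.of_bound hfm.aestronglyMeasurable R (hfC.mono fun x hx => hR _ hx)
  have hval : ∀ m : Fin (M + 1), (∫ x, f x ∂ν) m = (m : ℕ).factorial := by
    intro m
    have h1 : (∫ x, f x ∂ν) m = ∫ x, f x m ∂ν :=
      ((ContinuousLinearMap.proj (R := ℝ) (φ := fun _ : Fin (M + 1) => ℝ) m).integral_comp_comm
        hfint).symm
    rw [h1, integral_withDensity_eq_integral_smul hD, ← Real.Gamma_nat_eq_factorial,
      Real.Gamma_eq_integral (by positivity)]
    refine setIntegral_congr_fun measurableSet_Ioi fun x hx => ?_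
    have hx : 0 < x := hx
    have h2 : (D x : ℝ) = (1 + x) ^ (M + 1) * Real.exp (-x) :=
      Real.coe_toNNReal _ (by positivity)
    have h3 : 1 - x / (1 + x) = 1 / (1 + x) := by field_simp; ring
    have h4 : (1 + x) ^ (M + 1) = (1 + x) ^ (m : ℕ) * (1 + x) ^ (M + 1 - m) := by
      rw [← pow_add]; congr 1; omega
    simp only [NNReal.smul_def, smul_eq_mul, h2, f, g, h3, h4, div_pow, one_pow,
      add_sub_cancel_right, Real.rpow_natCast]
    field_simp
  have hν : NeZero ν := ⟨fun h0 => by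
    have := hval 0
    rw [h0] at this
    simp at this⟩
  have havg := (convex_convexHull ℝ (g '' Set.Icc 0 1)).average_mem hC.isClosed hfC hfint
  rw [average_eq, convexHull_eq] at havg
  obtain ⟨ι, t, w, z, hw, hw1, hz, hsum⟩ := havg
  rw [Finset.centerMass_eq_of_sum_1 _ _ hw1] at hsum
  have hpos : 0 < ν.real Set.univ := measureReal_univ_pos
  choose! s hs hgs using hz
  refine ⟨t, inferInstance, fun j => ν.real Set.univ * w j * (1 - s j) ^ (M + 1),
    fun j => s j / (1 - s j), fun j => ?_, fun j => ?_, fun m hm => ?_⟩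
  · have := (hs j j.2).2
    exact mul_nonneg (mul_nonneg hpos.le (hw j j.2)) (pow_nonneg (by linarith) _)
  · exact div_nonneg (hs j j.2).1 (by linarith [(hs j j.2).2])
  · have h5 := congrFun hsum ⟨m, by omega⟩
    rw [Pi.smul_apply, hval, Finset.sum_apply, smul_eq_mul, eq_inv_mul_iff_mul_eq₀ hpos.ne',
      ← Finset.sum_coe_sort t, Finset.mul_sum] at h5
    simp only [] at h5
    rw [← h5]
    refine Finset.sum_congr rfl fun j _ => ?_
    rw [← hgs j j.2, Pi.smul_apply, smul_eq_mul]
    simp only [g]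
    -- For `s = 1` the node is `1 / 0 = 0`, with weight zero.
    rcases eq_or_ne (1 - s j) 0 with h0 | h0
    · rw [h0, zero_pow (by omega), zero_pow (by omega)]; simp
    · have h4 : (1 - s j) ^ (M + 1) = (1 - s j) ^ m * (1 - s j) ^ (M + 1 - m) := by
        rw [← pow_add]; congr 1; omega
      rw [h4, div_pow]
      field_simp

/-- Orthogonality of characters of the cyclic group, as used to average over phases. -/
lemma sum_rootOfUnity_pow {n : ℕ} {ζ : ℂ} (hζ : IsPrimitiveRoot ζ n) {a b : ℕ}
    (ha : a < n) (hb : b < n) :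
    ∑ k : Fin n, (ζ ^ (k : ℕ)) ^ a * star (ζ ^ (k : ℕ)) ^ b = if a = b then (n : ℂ) else 0 := by
  have hunit : ζ * star ζ = 1 := by
    have : ‖ζ‖ = 1 := hζ.norm'_eq_one (by omega)
    rw [Complex.star_def, Complex.mul_conj, Complex.normSq_eq_norm_sq, this]; simp
  have hη : ∀ k : ℕ, (ζ ^ k) ^ a * star (ζ ^ k) ^ b = (ζ ^ a * star ζ ^ b) ^ k := by
    intro k; rw [star_pow]; ring
  simp only [hη]
  rw [Fin.sum_univ_eq_sum_range (fun k => (ζ ^ a * star ζ ^ b) ^ k)]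
  split_ifs with hab
  · subst hab
    rw [← mul_pow, hunit]; simp
  · have h1 : ζ ^ a * star ζ ^ b ≠ 1 := by
      intro h
      refine hab (hζ.pow_inj ha hb ?_)
      calc ζ ^ a = ζ ^ a * (ζ * star ζ) ^ b := by rw [hunit]; simp
        _ = (ζ ^ a * star ζ ^ b) * ζ ^ b := by ring
        _ = ζ ^ b := by rw [h, one_mul]
    have h2 : (ζ ^ a * star ζ ^ b) ^ n = 1 := by
      rw [mul_pow, ← pow_mul, ← pow_mul, mul_comm a, mul_comm b, pow_mul, pow_mul, ← star_pow,
        hζ.pow_eq_one]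
      simp
    have h3 := geom_sum_mul (ζ ^ a * star ζ ^ b) n
    rw [h2, sub_self] at h3
    exact (mul_eq_zero.mp h3).resolve_right (sub_ne_zero.mpr h1)

/-- A finite quadrature rule in `ℂ` that is exact on `zᵃ z̄ᵇ`, `a, b ≤ M`, for the Gaussian measure
`π⁻¹ exp(-|z|²)`: radii from `exists_finite_factorial_moments` with `x = |z|²`, phases from the
`(M + 1)`-st roots of unity. -/
lemma exists_complex_quadrature (M : ℕ) :
    ∃ (ι : Type) (_ : Fintype ι) (w : ι → ℝ) (z : ι → ℂ), (∀ j, 0 ≤ w j) ∧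
      ∀ a ≤ M, ∀ b ≤ M,
        ∑ j, (w j : ℂ) * (z j ^ a * star (z j) ^ b) = if a = b then (a.factorial : ℂ) else 0 := by
  obtain ⟨ι, _, w, x, hw, hx, hm⟩ := exists_finite_factorial_moments M
  have hζ := Complex.isPrimitiveRoot_exp (M + 1) (by omega)
  set ζ := Complex.exp (2 * Real.pi * Complex.I / (M + 1 : ℕ))
  refine ⟨ι × Fin (M + 1), inferInstance, fun j => w j.1 / (M + 1),
    fun j => (√(x j.1) : ℝ) * ζ ^ (j.2 : ℕ), fun j => div_nonneg (hw _) (by positivity),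
    fun a ha b hb => ?_⟩
  have hM : (M : ℂ) + 1 ≠ 0 := by exact_mod_cast M.succ_ne_zero
  have h1 : ∀ (j : ι) (k : Fin (M + 1)),
      ((w j / (M + 1) : ℝ) : ℂ) * (((√(x j) : ℝ) * ζ ^ (k : ℕ)) ^ a *
        star ((√(x j) : ℝ) * ζ ^ (k : ℕ)) ^ b) =
      (w j * (√(x j) : ℝ) ^ (a + b) / (M + 1)) *
        ((ζ ^ (k : ℕ)) ^ a * star (ζ ^ (k : ℕ)) ^ b) := by
    intro j k
    rw [star_mul', Complex.star_def, Complex.conj_ofReal]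
    push_cast
    ring
  rw [Fintype.sum_prod_type]
  simp only [h1, ← Finset.mul_sum]
  rw [sum_rootOfUnity_pow hζ (by omega) (by omega), ← Finset.sum_mul]
  split_ifs with hab
  · subst hab
    rw [← Complex.ofReal_natCast a.factorial, ← hm a ha]
    push_cast
    rw [Finset.sum_mul]
    refine Finset.sum_congr rfl fun j _ => ?_
    have : ((√(x j) : ℝ) : ℂ) ^ (a + a) = (x j : ℂ) ^ a := by
      rw [← two_mul, pow_mul, ← Complex.ofReal_pow, Real.sq_sqrt (hx j)]
    rw [this]
    field_simp
  · simp

/-! ### Positive matrices and separability of countable sums of products -/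

lemma eq_zero_of_posSemidef_of_diag_eq_zero {ι : Type*} {M : Matrix ι ι ℂ} (hM : M.PosSemidef)
    (h : ∀ i, M i i = 0) : M = 0 := by
  ext i j
  have h1 := hM.submatrix ![i, j]
  have h2 := h1.trace_eq_zero_iff.mp (by
    rw [Matrix.trace_fin_two]; simp [h])
  simpa using congrFun (congrFun h2 0) 1

lemma isDensity_single {ι : Type*} [DecidableEq ι] (i : ι) :
    IsDensity (Matrix.diagonal (Pi.single i (1 : ℂ))) := by
  refine ⟨Matrix.posSemidef_diagonal_iff.mpr fun j => ?_, ?_⟩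
  · by_cases h : j = i <;> simp [h]
  · simpa using hasSum_pi_single i (1 : ℂ)

/-- A positive trace-class matrix is its trace times a density matrix. -/
lemma exists_eq_smul_isDensity {ι : Type*} [Nonempty ι] {M : Matrix ι ι ℂ} (hM : M.PosSemidef)
    (hs : Summable fun i => M i i) :
    ∃ (c : ℝ) (D : Matrix ι ι ℂ), 0 ≤ c ∧ IsDensity D ∧ M = (c : ℂ) • D := by
  classical
  have hnn : (0 : ℂ) ≤ ∑' i, M i i := tsum_nonneg fun i => hM.diag_nonneg
  obtain ⟨c, hc, hcs⟩ : ∃ c : ℝ, 0 ≤ c ∧ ∑' i, M i i = c := by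
    refine ⟨(∑' i, M i i).re, (Complex.le_def.mp hnn).1, ?_⟩
    exact Complex.eq_re_of_ofReal_le (r := 0) (by simpa using hnn)
  have hsum : HasSum (fun i => M i i) (c : ℂ) := hcs ▸ hs.hasSum
  rcases eq_or_ne c 0 with rfl | h0
  · refine ⟨0, _, le_rfl, isDensity_single (Classical.arbitrary ι), ?_⟩
    rw [Complex.ofReal_zero] at hsum
    have := (hasSum_zero_iff_of_nonneg fun i => hM.diag_nonneg).mp hsum
    rw [Complex.ofReal_zero, zero_smul]
    exact eq_zero_of_posSemidef_of_diag_eq_zero hM fun i => congrFun this i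
  · have hc0 : (c : ℂ) ≠ 0 := by exact_mod_cast h0
    refine ⟨c, (c : ℂ)⁻¹ • M, hc, ⟨hM.smul ?_, ?_⟩, ?_⟩
    · exact_mod_cast inv_nonneg.mpr hc
    · simpa [hc0] using hsum.mul_left (c : ℂ)⁻¹
    · rw [smul_smul, mul_inv_cancel₀ hc0, one_smul]

lemma IsDensity.diag_re {ι : Type*} {M : Matrix ι ι ℂ} (hM : IsDensity M) :
    (∀ i, 0 ≤ (M i i).re) ∧ (∀ i, ((M i i).re : ℂ) = M i i) ∧
      HasSum (fun i => (M i i).re) 1 :=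
  ⟨fun i => (Complex.le_def.mp hM.1.diag_nonneg).1,
    fun i => (Complex.eq_re_of_ofReal_le (r := 0) (by simpa using hM.1.diag_nonneg)).symm,
    by simpa using Complex.hasSum_re hM.2⟩

/-- A trace-one matrix that is a countable sum of tensor products of positive trace-class matrices
is separable. -/
lemma isSeparable_of_hasSum {α ε X : Type*} [Countable X] {τ : Matrix (α × ε) (α × ε) ℂ}
    {A : X → Matrix α α ℂ} {B : X → Matrix ε ε ℂ}
    (hA : ∀ x, (A x).PosSemidef) (hAs : ∀ x, Summable fun a => A x a a)
    (hB : ∀ x, (B x).PosSemidef) (hBs : ∀ x, Summable fun e => B x e e)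
    (hτ : ∀ s t : α × ε, HasSum (fun x => A x s.1 t.1 * B x s.2 t.2) (τ s t))
    (htr : HasSum (fun s => τ s s) 1) : IsSeparable τ := by
  classical
  have hne : Nonempty (α × ε) := by
    by_contra h
    rw [not_nonempty_iff] at h
    exact zero_ne_one (hasSum_empty.unique htr)
  have hα : Nonempty α := hne.map Prod.fst
  have hε : Nonempty ε := hne.map Prod.snd
  choose a D ha hD hAD using fun x => exists_eq_smul_isDensity (hA x) (hAs x)
  choose b G hb hG hBG using fun x => exists_eq_smul_isDensity (hB x) (hBs x)
  -- The weights are summed by exchanging the sum over `x` with the trace.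
  have hτ' : ∀ s t : α × ε,
      HasSum (fun x => ((a x * b x : ℝ) : ℂ) * (D x s.1 t.1 * G x s.2 t.2)) (τ s t) := by
    intro s t
    convert hτ s t using 2 with x
    rw [hAD x, hBG x]
    simp only [Matrix.smul_apply, smul_eq_mul]
    push_cast; ring
  have hp : HasSum (fun x => a x * b x) 1 := by
    let F : (α × ε) × X → ℝ := fun y =>
      a y.2 * b y.2 * ((D y.2 y.1.1 y.1.1).re * (G y.2 y.1.2 y.1.2).re)
    have hF : 0 ≤ F := fun y => mul_nonneg (mul_nonneg (ha _) (hb _))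
      (mul_nonneg ((hD _).diag_re.1 _) ((hG _).diag_re.1 _))
    have h1 : ∀ s, HasSum (fun x => F (s, x)) (τ s s).re := by
      intro s
      convert Complex.hasSum_re (hτ' s s) using 2 with x
      rw [← (hD x).diag_re.2.1, ← (hG x).diag_re.2.1, ← Complex.ofReal_mul, ← Complex.ofReal_mul,
        Complex.ofReal_re]
    have h2 : ∀ x, HasSum (fun s => F (s, x)) (a x * b x) := by
      intro x
      have hd := (hD x).diag_re
      have hg := (hG x).diag_re
      simpa using (hd.2.2.mul hg.2.2
        (hd.2.2.summable.mul_of_nonneg hg.2.2.summable hd.1 hg.1)).mul_left (a x * b x)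
    have h3 : HasSum (fun s => (τ s s).re) 1 := by simpa using Complex.hasSum_re htr
    have hsum : Summable F := (summable_prod_of_nonneg hF).mpr
      ⟨fun s => (h1 s).summable, by simpa only [(h1 _).tsum_eq] using h3.summable⟩
    have hF1 : HasSum F 1 := by
      have := hsum.hasSum
      rwa [(this.prod_fiberwise h1).unique h3] at this
    exact ((Equiv.prodComm X (α × ε)).hasSum_iff.mpr hF1).prod_fiberwise h2
  obtain ⟨g, hg⟩ := exists_injective_nat X
  let D₀ := Matrix.diagonal (Pi.single (Classical.arbitrary α) (1 : ℂ))
  let G₀ := Matrix.diagonal (Pi.single (Classical.arbitrary ε) (1 : ℂ))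
  refine ⟨Function.extend g (fun x => a x * b x) 0, Function.extend g D fun _ => D₀,
    Function.extend g G fun _ => G₀, fun k => ?_, (hasSum_extend_zero hg).mpr hp,
    fun k => ?_, fun k => ?_, fun s t => ?_⟩
  · by_cases hk : ∃ x, g x = k
    · obtain ⟨x, rfl⟩ := hk
      rw [hg.extend_apply]; exact mul_nonneg (ha x) (hb x)
    · rw [Function.extend_apply' _ _ _ hk]; exact le_rfl
  · by_cases hk : ∃ x, g x = k
    · obtain ⟨x, rfl⟩ := hk
      rw [hg.extend_apply]; exact hD x
    · rw [Function.extend_apply' _ _ _ hk]; exact isDensity_single _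
  · by_cases hk : ∃ x, g x = k
    · obtain ⟨x, rfl⟩ := hk
      rw [hg.extend_apply]; exact hG x
    · rw [Function.extend_apply' _ _ _ hk]; exact isDensity_single _
  · refine (hg.hasSum_iff fun k hk => ?_).mp ?_
    · rw [Function.extend_apply' _ _ _ hk]; simp
    · convert hτ' s t using 2 with x
      simp only [Function.comp_apply, hg.extend_apply]

lemma posSemidef_vecMulVec_star {ι : Type*} (u : ι → ℂ) :
    (Matrix.vecMulVec u (star u)).PosSemidef := by
  refine ⟨?_, fun x => ?_⟩
  · ext i j
    simp [Matrix.vecMulVec_apply, mul_comm]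
  · have : (x.sum fun i xi => x.sum fun j xj => star xi * Matrix.vecMulVec u (star u) i j * xj) =
        star (x.sum fun j xj => star (u j) * xj) * x.sum fun j xj => star (u j) * xj := by
      simp only [Finsupp.sum, star_sum, Finset.sum_mul, Finset.mul_sum, Matrix.vecMulVec_apply,
        Pi.star_apply, star_mul', star_star]
      rw [Finset.sum_comm]
      refine Finset.sum_congr rfl fun i _ => Finset.sum_congr rfl fun j _ => ?_
      ring
    rw [this]
    exact star_mul_self_nonneg _

/-- Positivity of the reference state left behind when the input system of `ρ` is measured in the
unnormalised vector `z̄`. -/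
lemma posSemidef_sum_mul_star {α ι : Type*} [Fintype α] [Fintype ι]
    {ρ : Matrix (α × ι) (α × ι) ℂ} (hρ : ρ.PosSemidef) (z : ι → ℂ) :
    (Matrix.of fun a a' => ∑ i, ∑ j, ρ (a, i) (a', j) * (z i * star (z j))).PosSemidef := by
  classical
  convert hρ.conjTranspose_mul_mul_same
    (Matrix.of fun (x : α × ι) (a : α) => if x.1 = a then star (z x.2) else 0) using 1
  ext a a'
  simp only [Matrix.of_apply, Matrix.mul_apply, Matrix.conjTranspose_apply, Fintype.sum_prod_type,
    apply_ite star, star_zero, star_star, ite_mul, zero_mul, mul_ite, mul_zero, Finset.sum_mul]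
  simp only [Finset.sum_ite_irrel, Finset.sum_const_zero, Finset.sum_ite_eq', Finset.mem_univ,
    if_true]
  conv_rhs => rw [Finset.sum_comm]
  refine Finset.sum_congr rfl fun i _ => Finset.sum_congr rfl fun j _ => ?_
  ring

/-! ### Measure-and-prepare form of the complementary channel -/

lemma sum_add_single {d : ℕ} (e : Occ d) (i : Fin d) :
    ∑ k, (e + Pi.single i 1 : Occ d) k = ∑ k, e k + 1 := by
  simp [Finset.sum_add_distrib]

/-- Coefficients `∏ₖ zₖ^(eₖ) / √(eₖ!)` of the unnormalised coherent state of amplitude `z`,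
truncated to total excitation number `N`. -/
def truncCoherent {d : ℕ} (N : ℕ) (z : Fin d → ℂ) (e : Occ d) : ℂ :=
  if ∑ k, e k = N then ∏ k, z k ^ e k / (√(e k).factorial : ℝ) else 0

lemma summable_truncCoherent {d : ℕ} (N : ℕ) (z : Fin d → ℂ) :
    Summable fun e : Occ d =>
      Matrix.vecMulVec (truncCoherent N z) (star (truncCoherent N z)) e e := by
  refine summable_of_ne_finset_zero (s := Finset.piAntidiag Finset.univ N) fun e he => ?_
  have : ∑ k, e k ≠ N := by simpa using he
  simp [Matrix.vecMulVec_apply, truncCoherent, this]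

lemma prod_factorial_add_single {d : ℕ} (e : Occ d) (i : Fin d) :
    ∏ k, ((e + Pi.single i 1 : Occ d) k).factorial = (e i + 1) * ∏ k, (e k).factorial := by
  have : ∀ k, ((e + Pi.single i 1 : Occ d) k).factorial =
      (if k = i then e i + 1 else 1) * (e k).factorial := by
    intro k
    by_cases hk : k = i
    · subst hk; simp [Nat.factorial_succ]
    · simp [hk]
  simp only [this, Finset.prod_mul_distrib]
  simp

/-- Products of a one-variable quadrature rule. -/
lemma sum_prod_quadrature {d M : ℕ} {ι : Type} [Fintype ι] {w : ι → ℝ} {z : ι → ℂ}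
    (hq : ∀ a ≤ M, ∀ b ≤ M,
      ∑ j, (w j : ℂ) * (z j ^ a * star (z j) ^ b) = if a = b then (a.factorial : ℂ) else 0)
    {g g' : Fin d → ℕ} (hg : ∀ k, g k ≤ M) (hg' : ∀ k, g' k ≤ M) :
    ∑ J : Fin d → ι, ∏ k, (w (J k) : ℂ) * (z (J k) ^ g k * star (z (J k)) ^ g' k) =
      if g = g' then ((∏ k, (g k).factorial : ℕ) : ℂ) else 0 := by
  rw [← Fintype.prod_sum fun k l => (w l : ℂ) * (z l ^ g k * star (z l) ^ g' k)]
  simp only [hq _ (hg _) _ (hg' _)]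
  rw [Finset.prod_ite_zero]
  simp only [Finset.mem_univ, true_imp_iff, funext_iff, Nat.cast_prod]

lemma mul_prod_pow_eq {d : ℕ} (v : Fin d → ℂ) (f : Occ d) (l : Fin d) :
    v l * ∏ k, v k ^ f k = ∏ k, v k ^ (f + Pi.single l 1 : Occ d) k := by
  simp only [Pi.add_apply, pow_add, Finset.prod_mul_distrib]
  rw [mul_comm, Finset.prod_eq_single (s := Finset.univ) (f := fun k =>
    v k ^ (Pi.single l 1 : Occ d) k) l]
  · simp
  · intro k _ hk; simp [hk]
  · simp

lemma truncCoherent_of_sum_eq {d N : ℕ} (z : Fin d → ℂ) {e : Occ d} (he : ∑ k, e k = N) :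
    truncCoherent N z e = (∏ k, z k ^ e k) * ((√(∏ k, (e k).factorial : ℕ) : ℝ) : ℂ)⁻¹ := by
  rw [Nat.cast_prod, Real.sqrt_prod _ fun k _ => by positivity, truncCoherent, if_pos he,
    Finset.prod_div_distrib, div_eq_mul_inv, Complex.ofReal_prod]

lemma sqrt_factorial_mul_sqrt {d : ℕ} {e e' : Occ d} {i j : Fin d}
    (h : e + Pi.single i 1 = e' + Pi.single j 1) :
    ((∏ k, ((e + Pi.single i 1 : Occ d) k).factorial : ℕ) : ℝ) =
      (√((e i : ℝ) + 1) * √(∏ k, (e k).factorial : ℕ)) *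
        (√((e' j : ℝ) + 1) * √(∏ k, (e' k).factorial : ℕ)) := by
  have h1 : ((e i : ℝ) + 1) * (∏ k, (e k).factorial : ℕ) =
      (∏ k, ((e + Pi.single i 1 : Occ d) k).factorial : ℕ) := by
    rw [prod_factorial_add_single]; push_cast; ring
  have h2 : ((e' j : ℝ) + 1) * (∏ k, (e' k).factorial : ℕ) =
      (∏ k, ((e + Pi.single i 1 : Occ d) k).factorial : ℕ) := by
    rw [h, prod_factorial_add_single]; push_cast; ring
  rw [← Real.sqrt_mul (by positivity), ← Real.sqrt_mul (by positivity), h1, h2,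
    Real.mul_self_sqrt (Nat.cast_nonneg _)]

/-- A product quadrature rule reproduces the Gaussian moments that govern the complementary
channel on the block with `N` excitations. -/
lemma sum_quadrature_truncCoherent {d N : ℕ} (r : ℝ) {ι : Type} [Fintype ι] {w : ι → ℝ}
    {z : ι → ℂ}
    (hq : ∀ a ≤ N + 1, ∀ b ≤ N + 1,
      ∑ j, (w j : ℂ) * (z j ^ a * star (z j) ^ b) = if a = b then (a.factorial : ℂ) else 0)
    {e e' : Occ d} (he : ∑ k, e k = N) (he' : ∑ k, e' k = N) (i j : Fin d) :
    (((Real.cosh r)⁻¹ ^ (d + 1) * Real.tanh r ^ N : ℝ) : ℂ) ^ 2 *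
      ∑ J : Fin d → ι, (∏ k, (w (J k) : ℂ)) * ((z (J i) * star (z (J j))) *
        (truncCoherent N (z ∘ J) e * star (truncCoherent N (z ∘ J) e'))) =
      if e + Pi.single i 1 = e' + Pi.single j 1 then
        (amplitude r e i * amplitude r e' j : ℂ) else 0 := by
  have hle : ∀ (f : Occ d) (l k : Fin d), ∑ k, f k = N →
      (f + Pi.single l 1 : Occ d) k ≤ N + 1 := by
    intro f l k hf
    rw [← hf, ← sum_add_single f l]
    exact Finset.single_le_sum (f := (f + Pi.single l 1 : Occ d)) (fun _ _ => Nat.zero_le _)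
      (Finset.mem_univ k)
  set R : Occ d → ℝ := fun f => √(∏ k, (f k).factorial : ℕ)
  have hterm : ∀ J : Fin d → ι, (∏ k, (w (J k) : ℂ)) * ((z (J i) * star (z (J j))) *
        (truncCoherent N (z ∘ J) e * star (truncCoherent N (z ∘ J) e'))) =
      (∏ k, (w (J k) : ℂ) * (z (J k) ^ (e + Pi.single i 1 : Occ d) k *
        star (z (J k)) ^ (e' + Pi.single j 1 : Occ d) k)) * ((R e : ℂ)⁻¹ * (R e' : ℂ)⁻¹) := by
    intro J
    have h1 := mul_prod_pow_eq (fun k => z (J k)) e i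
    have h2 := mul_prod_pow_eq (fun k => star (z (J k))) e' j
    have h3 : star (truncCoherent N (z ∘ J) e') =
        (∏ k, star (z (J k)) ^ e' k) * (R e' : ℂ)⁻¹ := by
      rw [truncCoherent_of_sum_eq _ he', star_mul', star_prod, star_inv₀, Complex.star_def,
        Complex.conj_ofReal]
      simp only [map_pow, Function.comp_apply, R]
    rw [Finset.prod_mul_distrib, Finset.prod_mul_distrib, ← h1, ← h2, h3,
      truncCoherent_of_sum_eq _ he]
    simp only [Function.comp_apply, R]
    ring
  rw [Finset.sum_congr rfl fun J _ => hterm J, ← Finset.sum_mul,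
    sum_prod_quadrature hq (fun k => hle e i k he) (fun k => hle e' j k he')]
  split_ifs with h
  · have hpos : ∀ f : Occ d, (R f : ℂ) ≠ 0 := fun f => Complex.ofReal_ne_zero.mpr
      (Real.sqrt_pos.mpr (Nat.cast_pos.mpr
        (Finset.prod_pos fun k _ => (f k).factorial_pos))).ne'
    rw [← Complex.ofReal_natCast, sqrt_factorial_mul_sqrt h, amplitude, amplitude, he, he']
    -- State the goal in terms of `R`, which hides the factorials from `field_simp`.
    change _ * (((√((e i : ℝ) + 1) * R e * (√((e' j : ℝ) + 1) * R e') : ℝ) : ℂ) * _) = _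
    have h1 := hpos e
    have h2 := hpos e'
    clear_value R
    simp only [Complex.ofReal_mul]
    field_simp
  · rw [zero_mul, mul_zero]

lemma ampliation_unruhComplement_apply {d n : ℕ} (r : ℝ)
    (ρ : Matrix (Fin n × Fin d) (Fin n × Fin d) ℂ) (a a' : Fin n) (e e' : Occ d) :
    ampliation (Fin n) (unruhComplement d r) ρ (a, e) (a', e') = ∑ i, ∑ j,
      if e + Pi.single i 1 = e' + Pi.single j 1 then
        ρ (a, i) (a', j) * (amplitude r e i * amplitude r e' j) else 0 :=
  unruhComplement_apply d r (Matrix.of fun i j => ρ (a, i) (a', j)) e e'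

/-- The complementary channel preserves the trace, also with a reference system attached. -/
lemma hasSum_diag_ampliation {d n : ℕ} (r : ℝ) {ρ : Matrix (Fin n × Fin d) (Fin n × Fin d) ℂ}
    (hρ : IsDensity ρ) :
    HasSum (fun s => ampliation (Fin n) (unruhComplement d r) ρ s s) 1 := by
  have h : ∀ s : Fin n × Occ d, ampliation (Fin n) (unruhComplement d r) ρ s s =
      ∑ y, if s.1 = y.1 then ρ y y * ((amplitude r s.2 y.2 ^ 2 : ℝ) : ℂ) else 0 := by
    rintro ⟨a, e⟩
    rw [Fintype.sum_prod_type, Finset.sum_eq_single a]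
    · simp only [ampliation_unruhComplement_apply, if_true]
      refine Finset.sum_congr rfl fun i _ => ?_
      rw [Finset.sum_eq_single i]
      · simp [sq]
      · intro j _ hj
        rw [if_neg]
        intro h
        have := congrFun (add_left_cancel h) j
        simp [hj] at this
      · simp
    · intro b _ hb; simp [hb.symm]
    · simp
  simp only [h]
  rw [← (hasSum_fintype fun y => ρ y y).unique hρ.2]
  refine hasSum_sum fun y _ => ?_
  have hinj : Function.Injective fun e : Occ d => (y.1, e) := Prod.mk_right_injective _
  refine (hinj.hasSum_iff fun s hs => ?_).mp ?_
  · rw [if_neg]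
    rintro h
    exact hs ⟨s.2, by rw [← h]⟩
  · have := (Complex.hasSum_ofReal.mpr (hasSum_amplitude_sq r y.2)).mul_left (ρ y y)
    simpa [Function.comp_def] using this

/-- Measuring the input in the quadrature nodes and preparing truncated coherent states reproduces
the complementary channel. -/
lemma isEntanglementBreaking_unruhComplement (d : ℕ) (r : ℝ) :
    IsEntanglementBreaking (unruhComplement d r) := by
  intro n ρ hρ
  choose ι _ w z hw hq using fun N : ℕ => exists_complex_quadrature (N + 1)
  let X := Σ N : ℕ, (Fin d → ι N)
  let c : X → ℝ := fun x =>
    ((Real.cosh r)⁻¹ ^ (d + 1) * Real.tanh r ^ x.1) ^ 2 * ∏ k, w x.1 (x.2 k)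
  have hc : ∀ x, 0 ≤ c x := fun x =>
    mul_nonneg (sq_nonneg _) (Finset.prod_nonneg fun k _ => hw _ _)
  let A : X → Matrix (Fin n) (Fin n) ℂ := fun x => (c x : ℂ) • Matrix.of fun a a' =>
    ∑ i, ∑ j, ρ (a, i) (a', j) * (z x.1 (x.2 i) * star (z x.1 (x.2 j)))
  let B : X → Matrix (Occ d) (Occ d) ℂ := fun x => Matrix.vecMulVec
    (truncCoherent x.1 (z x.1 ∘ x.2)) (star (truncCoherent x.1 (z x.1 ∘ x.2)))
  refine isSeparable_of_hasSum (A := A) (B := B) (fun x => ?_)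
    (fun x => (hasSum_fintype _).summable) (fun x => posSemidef_vecMulVec_star _)
    (fun x => summable_truncCoherent _ _) (fun s t => ?_) (hasSum_diag_ampliation r hρ)
  · exact (posSemidef_sum_mul_star hρ.1 fun i => z x.1 (x.2 i)).smul (by exact_mod_cast hc x)
  obtain ⟨a, e⟩ := s
  obtain ⟨a', e'⟩ := t
  rw [ampliation_unruhComplement_apply]
  by_cases hee : ∑ k, e k = ∑ k, e' k
  · -- Only the block that contains both number states contributes, and it is a finite sum.
    set N := ∑ k, e k with hN
    refine ((sigma_mk_injective (i := N)).hasSum_iff fun x hx => ?_).mp ?_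
    · have : N ≠ x.1 := by
        rintro h
        exact hx ⟨h ▸ x.2, by obtain ⟨M, J⟩ := x; simp only at h; subst h; rfl⟩
      simp [B, Matrix.vecMulVec_apply, truncCoherent, ← hN, this]
    · have key : (∑ i, ∑ j, if e + Pi.single i 1 = e' + Pi.single j 1 then
          ρ (a, i) (a', j) * (amplitude r e i * amplitude r e' j : ℂ) else 0) =
          ∑ J : Fin d → ι N, A ⟨N, J⟩ a a' * B ⟨N, J⟩ e e' := by
        simp only [← mul_ite_zero, ← sum_quadrature_truncCoherent r (hq N) hN.symm hee.symm]
        simp only [A, B, c, Matrix.smul_apply, Matrix.of_apply, Matrix.vecMulVec_apply,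
          smul_eq_mul, Finset.mul_sum, Finset.sum_mul, Pi.star_apply]
        rw [Finset.sum_comm_cycle]
        refine Finset.sum_congr rfl fun J _ => ?_
        refine Finset.sum_congr rfl fun i _ => Finset.sum_congr rfl fun j _ => ?_
        push_cast
        ring
      rw [key]
      exact hasSum_fintype _
  · -- Entries between different blocks vanish on both sides.
    convert hasSum_zero using 1
    · funext x
      by_cases h1 : ∑ k, e k = x.1
      · have h2 : ∑ k, e' k ≠ x.1 := fun h => hee (h1.trans h.symm)
        simp [B, Matrix.vecMulVec_apply, truncCoherent, h2]
      · simp [B, Matrix.vecMulVec_apply, truncCoherent, h1]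
    · refine Finset.sum_eq_zero fun i _ => Finset.sum_eq_zero fun j _ => if_neg fun h => hee ?_
      have := sum_add_single e i
      rw [h, sum_add_single] at this
      omega

end QuditUnruh

end

theorem theorem2 (d : ℕ) (hd : 1 ≤ d) (r : ℝ) :
    QuditUnruh.IsHadamard (QuditUnruh.unruhChannel d r) ∧
      QuditUnruh.IsComplementary (QuditUnruh.unruhChannel d r) (QuditUnruh.unruhComplement d r) ∧
      QuditUnruh.IsEntanglementBreaking (QuditUnruh.unruhComplement d r) :=
  ⟨⟨_, _, QuditUnruh.isComplementary_unruh d r,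
    QuditUnruh.isEntanglementBreaking_unruhComplement d r⟩,
    QuditUnruh.isComplementary_unruh d r, QuditUnruh.isEntanglementBreaking_unruhComplement d r⟩
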